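/- All graphs are finite and simple. A cactus is a connected graph in which each edge lies on at most one cycle. A chain cactus is a cactus in which each block is a cycle containing at most two cut vertices and each cut vertex lies on exactly two cycles; its length is the number of its cycles, and the one-vertex graph counts as the chain cactus of length $0$. The cycles of a chain cactus of length $n$ are listed in their order along the chain as $C^{(1)},\dots,C^{(n)}$, so that two different cycles share a vertex exactly when they are consecutive; the cycles other than $C^{(1)}$ and $C^{(n)}$ are called internal. A chain cactus is an ortho-chain (respectively a meta-chain) if in every internal cycle the two cut vertices are at distance $1$ (respectively $2$). Write $\Psi(G)$ for the number of independent vertex sets of $G$, the empty set included. Theorem. Let $A_n$ be a chain cactus of length $n$, and let $O_n$ and $M_n$ be an ortho-chain and a meta-chain of length $n$ such that, for suitable listings of the cycles in order along the chains and for every $i=1,\dots,n$, the $i$-th cycles $C^{(i)}$ of $A_n$, $O_n$ and $M_n$ have the same number $h_i$ of vertices. If $A_n$ is isomorphic neither to $O_n$ nor to $M_n$, then $$\Psi(O_n)<\Psi(A_n)<\Psi(M_n).$$ -/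

import Mathlib

namespace ChainCacti

variable {V : Type*}

/-- A cut vertex of a (connected) graph: deleting it disconnects the graph. -/
def IsCutVertex (G : SimpleGraph V) (v : V) : Prop :=
  ¬ (G.induce ({v}ᶜ : Set V)).Preconnected

/-- A subgraph which is a cycle of `G` (it automatically has at least three vertices). -/
def IsCycleSubgraph {G : SimpleGraph V} (H : G.Subgraph) : Prop :=
  ∃ (v : V) (c : G.Walk v v), c.IsCycle ∧ c.toSubgraph = H

/-- A block: a maximal connected subgraph that has no cut vertex of its own. -/
def IsBlock {G : SimpleGraph V} (B : G.Subgraph) : Prop :=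
  Maximal (fun H : G.Subgraph => H.Connected ∧ ∀ v, ¬ IsCutVertex H.coe v) B

/-- A cactus: a connected graph in which each edge lies on at most one cycle. -/
def IsCactus (G : SimpleGraph V) : Prop :=
  G.Connected ∧
    ∀ C D : G.Subgraph, IsCycleSubgraph C → IsCycleSubgraph D →
      ∀ e : Sym2 V, e ∈ C.edgeSet → e ∈ D.edgeSet → C = D

/-- A chain cactus: a cactus in which each block is a cycle containing at most two cut vertices
and each cut vertex lies on exactly two cycles. The one-vertex graph is a chain cactus
(of length `0`) by convention. -/
def IsChainCactus (G : SimpleGraph V) : Prop :=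
  IsCactus G ∧
    (Nat.card V = 1 ∨
      (∀ B : G.Subgraph, IsBlock B →
        IsCycleSubgraph B ∧ {v | v ∈ B.verts ∧ IsCutVertex G v}.encard ≤ 2) ∧
      (∀ v, IsCutVertex G v → {C : G.Subgraph | IsCycleSubgraph C ∧ v ∈ C.verts}.encard = 2))

/-- `G` is a chain cactus of length `n` and `C 0, …, C (n - 1)` are its cycles, each listed once,
by order on the chain: two different cycles meet exactly when they are consecutive. -/
structure IsChainCactusWith (G : SimpleGraph V) {n : ℕ} (C : Fin n → G.Subgraph) : Prop where
  isChainCactus : IsChainCactus G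
  injective : Function.Injective C
  range_eq : Set.range C = {H : G.Subgraph | IsCycleSubgraph H}
  meet_iff : ∀ i j : Fin n, i ≠ j →
    (((C i).verts ∩ (C j).verts).Nonempty ↔ (i : ℕ) + 1 = j ∨ (j : ℕ) + 1 = i)

/-- The cycle `C` is in `k`-position: its two cut vertices are at distance `k` on it. -/
def InPosition {G : SimpleGraph V} (C : G.Subgraph) (k : ℕ) : Prop :=
  ∃ u v : C.verts, u ≠ v ∧ IsCutVertex G u ∧ IsCutVertex G v ∧ C.coe.dist u v = k

/-- All internal cycles (those other than the first and the last one) are in ortho-position,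
that is, in `1`-position. -/
def IsOrthoChain (G : SimpleGraph V) {n : ℕ} (C : Fin n → G.Subgraph) : Prop :=
  IsChainCactusWith G C ∧ ∀ i : Fin n, 0 < (i : ℕ) → (i : ℕ) + 1 < n → InPosition (C i) 1

/-- All internal cycles (those other than the first and the last one) are in meta-position,
that is, in `2`-position. -/
def IsMetaChain (G : SimpleGraph V) {n : ℕ} (C : Fin n → G.Subgraph) : Prop :=
  IsChainCactusWith G C ∧ ∀ i : Fin n, 0 < (i : ℕ) → (i : ℕ) + 1 < n → InPosition (C i) 2

/-- `Ψ(G)`: the total number of independent sets of `G` (the empty set included). -/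
noncomputable def numIndepSets (G : SimpleGraph V) : ℕ :=
  {S : Set V | G.IsIndepSet S}.ncard

end ChainCacti

/-! Cut the chain at its shared vertices. The independent sets of one cycle, sorted by membership of
its two attachment vertices, form a symmetric 2×2 matrix of products of Fibonacci numbers, and `Ψ`
is the sum of the entries of the product of these matrices.

The row sums of such a matrix depend only on the length `h`: fixing one vertex leaves a path to
count. So the only freedom in the position `k` is the (true, true) entry, and raising that entry by
`e` adds `e` times [[1, -1], [-1, 1]]. If the product to the left contributes the vector (a + x, a)
and the product to the right (b + y, b), the total grows by `e * x * y` (`cycleWeight_exchange`).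
Membership of a prescribed vertex is more restrictive than non-membership, so x and y are
nonnegative, and positive at internal cycles. Hence `Ψ` increases with every (true, true) entry,
strictly at internal cycles (`chainWeight_le_lt`). That entry is 0 exactly at `k = 1`, and by the
Fibonacci addition formula it is largest exactly at `k = 2`.

It remains to read these data off the graph. Blocks being cycles, distinct cycles meet in at most
one vertex, so a chain cactus can be labelled by its lengths and positions
(`IsChainCactusWith.exists_labelling`). The labelling data determine the graph up to isomorphism
(`nonempty_iso`), so a graph isomorphic to neither extremal chain differs from each at some internal
cycle. -/

namespace ChainCacti

/-! ### Transfer matrices and their monotonicity -/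

/-- Number of independent sets of a cycle of length `h` with prescribed membership of two vertices
at distance `k` along the cycle. -/
def cycleWeight (h k : ℕ) : Bool → Bool → ℕ
  | false, false => Nat.fib (k + 1) * Nat.fib (h - k + 1)
  | false, true => Nat.fib k * Nat.fib (h - k)
  | true, false => Nat.fib k * Nat.fib (h - k)
  | true, true => Nat.fib (k - 1) * Nat.fib (h - k - 1)

/-- Transfer-matrix product of the cycle weights along a chain, with prescribed initial state. -/
def chainWeight : {n : ℕ} → (Fin n → ℕ) → (Fin n → ℕ) → Bool → ℕ
  | 0, _, _, _ => 1
  | _ + 1, h, k, b =>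
    cycleWeight (h 0) (k 0) b false * chainWeight (fun i => h i.succ) (fun i => k i.succ) false +
    cycleWeight (h 0) (k 0) b true * chainWeight (fun i => h i.succ) (fun i => k i.succ) true

/-- `k` is the distance of two different vertices on a cycle of length `h`. -/
def IsPosition (h k : ℕ) : Prop := 1 ≤ k ∧ 2 * k ≤ h ∧ 3 ≤ h

theorem IsPosition.exists_eq {h k : ℕ} (H : IsPosition h k) :
    ∃ a b, a ≤ b ∧ 1 ≤ b ∧ k = a + 1 ∧ h - k = b + 1 ∧ h = a + b + 2 :=
  ⟨k - 1, h - k - 1, by unfold IsPosition at H; omega⟩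

/-- Excluding one vertex leaves a path on `h - 1` vertices, whatever `k` is; algebraically this is
the Fibonacci addition formula. -/
theorem cycleWeight_row_false {h k : ℕ} (H : IsPosition h k) :
    cycleWeight h k false false + cycleWeight h k false true = Nat.fib (h + 1) := by
  obtain ⟨a, b, -, -, hk, hb, hh⟩ := H.exists_eq
  simp only [cycleWeight, hb]
  rw [hk, hh, show a + b + 2 + 1 = (a + 1) + (b + 1) + 1 by ring, Nat.fib_add (a + 1) (b + 1)]
  ring

theorem cycleWeight_row_true {h k : ℕ} (H : IsPosition h k) :
    cycleWeight h k true false + cycleWeight h k true true = Nat.fib (h - 1) := by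
  obtain ⟨a, b, -, -, hk, hb, hh⟩ := H.exists_eq
  simp only [cycleWeight, hb]
  rw [hk, hh, show a + b + 2 - 1 = a + b + 1 by omega, Nat.fib_add a b]
  simp only [Nat.add_sub_cancel]
  ring

theorem cycleWeight_comm (h k : ℕ) (x y : Bool) : cycleWeight h k x y = cycleWeight h k y x := by
  cases x <;> cases y <;> rfl

theorem cycleWeight_lt {h k : ℕ} (H : IsPosition h k) :
    cycleWeight h k true false < cycleWeight h k false false := by
  obtain ⟨a, b, -, hb1, hk, hb, hh⟩ := H.exists_eq
  simp only [cycleWeight, hb]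
  rw [hk]
  have h1 : Nat.fib (a + 1) ≤ Nat.fib (a + 1 + 1) := Nat.fib_le_fib_succ
  have h2 : Nat.fib (b + 1) < Nat.fib (b + 1 + 1) := Nat.fib_lt_fib_succ (by omega)
  have h3 : 0 < Nat.fib (a + 1 + 1) := Nat.fib_pos.2 (by omega)
  exact Nat.mul_lt_mul_of_le_of_lt h1 h2 h3

theorem cycleWeight_le (h k : ℕ) :
    cycleWeight h k true true ≤ cycleWeight h k false true := by
  simp only [cycleWeight]
  exact Nat.mul_le_mul (Nat.fib_mono (by omega)) (Nat.fib_mono (by omega))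

/-- The `false` row of each matrix dominates the `true` row entrywise, strictly in the first column.
For the empty chain both weights are 1, which is why the position on the last cycle does not affect
the count. -/
theorem chainWeight_pos_and_le : ∀ {n : ℕ} (h k : Fin n → ℕ) (_ : ∀ i, IsPosition (h i) (k i)),
    0 < chainWeight h k false ∧ chainWeight h k true ≤ chainWeight h k false ∧
      (0 < n → chainWeight h k true < chainWeight h k false)
  | 0, _, _, _ => by simp [chainWeight]
  | _ + 1, h, k, H => by
    obtain ⟨h1, h2, -⟩ := chainWeight_pos_and_le (fun i => h i.succ) (fun i => k i.succ)
      (fun i => H i.succ)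
    have key : chainWeight h k true < chainWeight h k false := by
      simp only [chainWeight]
      exact Nat.add_lt_add_of_lt_of_le (Nat.mul_lt_mul_of_pos_right (cycleWeight_lt (H 0)) h1)
        (Nat.mul_le_mul_right _ (cycleWeight_le (h 0) (k 0)))
    exact ⟨lt_of_le_of_lt (Nat.zero_le _) key, key.le, fun _ => key⟩

/-- Changing the position of two attachment vertices on one cycle. -/
theorem cycleWeight_exchange {h k k' : ℕ} (H : IsPosition h k) (H' : IsPosition h k')
    {e : ℕ} (he : cycleWeight h k' true true = cycleWeight h k true true + e)
    (a x b y : ℕ) :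
    (a + x) * (cycleWeight h k' false false * (b + y) + cycleWeight h k' false true * b) +
      a * (cycleWeight h k' true false * (b + y) + cycleWeight h k' true true * b) =
    (a + x) * (cycleWeight h k false false * (b + y) + cycleWeight h k false true * b) +
      a * (cycleWeight h k true false * (b + y) + cycleWeight h k true true * b) + e * x * y := by
  have r1 := cycleWeight_row_false H
  have r2 := cycleWeight_row_false H'
  have r3 := cycleWeight_row_true H
  have r4 := cycleWeight_row_true H'
  rw [cycleWeight_comm h k false true, cycleWeight_comm h k' false true] at *
  generalize cycleWeight h k false false = p at *
  generalize cycleWeight h k true false = q at *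
  generalize cycleWeight h k true true = r at *
  generalize cycleWeight h k' false false = p' at *
  generalize cycleWeight h k' true false = q' at *
  generalize cycleWeight h k' true true = r' at *
  -- Equal row sums propagate the change `e` of the (true, true) entry to the other entries with
  -- alternating signs.
  obtain rfl : q = q' + e := by omega
  obtain rfl : p' = p + e := by omega
  subst he
  ring

/-- The induction carries an arbitrary left vector (a + x, a): change the head with the tail kept,
gaining `e * x * y`, then absorb the new head into the left vector and change the tail. -/
theorem chainWeight_mono : ∀ {n : ℕ} (h k k' : Fin n → ℕ)
    (_ : ∀ i, IsPosition (h i) (k i)) (_ : ∀ i, IsPosition (h i) (k' i))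
    (_ : ∀ i, cycleWeight (h i) (k i) true true ≤ cycleWeight (h i) (k' i) true true) (a x : ℕ),
    ((a + x) * chainWeight h k false + a * chainWeight h k true ≤
      (a + x) * chainWeight h k' false + a * chainWeight h k' true) ∧
    (0 < x → (∃ i : Fin n, (i : ℕ) + 1 < n ∧
        cycleWeight (h i) (k i) true true < cycleWeight (h i) (k' i) true true) →
      (a + x) * chainWeight h k false + a * chainWeight h k true <
      (a + x) * chainWeight h k' false + a * chainWeight h k' true)
  | 0, h, k, k', _, _, _, a, x => ⟨by simp [chainWeight], fun _ ⟨i, _⟩ => i.elim0⟩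
  | n + 1, h, k, k', H, H', hle, a, x => by
    obtain ⟨e, he⟩ := Nat.exists_eq_add_of_le (hle 0)
    obtain ⟨-, hb, hb'⟩ := chainWeight_pos_and_le (fun i => h i.succ) (fun i => k i.succ)
      (fun i => H i.succ)
    obtain ⟨y, hy⟩ := Nat.exists_eq_add_of_le hb
    have hex := cycleWeight_exchange (H 0) (H' 0) he a x
      (chainWeight (fun i => h i.succ) (fun i => k i.succ) true) y
    rw [← hy] at hex
    have h1 := cycleWeight_lt (H' 0)
    have h2 := cycleWeight_le (h 0) (k' 0)
    set p := cycleWeight (h 0) (k' 0) false false with hp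
    set q := cycleWeight (h 0) (k' 0) true false with hq
    have hqc : cycleWeight (h 0) (k' 0) false true = q := cycleWeight_comm _ _ _ _
    rw [hqc] at h2 hex
    set r := cycleWeight (h 0) (k' 0) true true with hr
    -- `z` is the difference of the two entries of the left vector after the head; it plays the role
    -- of `x` for the tail.
    obtain ⟨z, hz⟩ : ∃ z, (a + x) * p + a * q = ((a + x) * q + a * r) + z :=
      Nat.exists_eq_add_of_le (add_le_add (Nat.mul_le_mul_left _ h1.le) (Nat.mul_le_mul_left _ h2))
    have hzpos : 0 < x → 0 < z := by
      intro hx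
      have : (a + x) * q + a * r < (a + x) * p + a * q :=
        add_lt_add_of_lt_of_le (Nat.mul_lt_mul_of_pos_left h1 (by omega))
          (Nat.mul_le_mul_left _ h2)
      omega
    obtain ⟨ih1, ih2⟩ := chainWeight_mono (fun i => h i.succ) (fun i => k i.succ)
      (fun i => k' i.succ) (fun i => H i.succ) (fun i => H' i.succ) (fun i => hle i.succ)
      ((a + x) * q + a * r) z
    rw [← hz] at ih1 ih2
    simp only [chainWeight, ← hp, ← hq, hqc, ← hr]
    generalize chainWeight (fun i => h i.succ) (fun i => k i.succ) false = B0 at *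
    generalize chainWeight (fun i => h i.succ) (fun i => k i.succ) true = B1 at *
    generalize chainWeight (fun i => h i.succ) (fun i => k' i.succ) false = B0' at *
    generalize chainWeight (fun i => h i.succ) (fun i => k' i.succ) true = B1' at *
    have e1 : ∀ B0 B1 : ℕ, (a + x) * (p * B0 + q * B1) + a * (q * B0 + r * B1) =
      ((a + x) * p + a * q) * B0 + ((a + x) * q + a * r) * B1 := by intro _ _; ring
    rw [e1 B0' B1']
    rw [e1 B0 B1] at hex
    refine ⟨by omega, fun hx ⟨i, hi, hlt⟩ => ?_⟩
    cases i using Fin.cases with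
    | zero =>
      have : 0 < e * x * y := by
        have hy0 : B1 < B0 := hb' (by simpa using hi)
        have : 0 < y := by omega
        have : 0 < e := by omega
        positivity
      omega
    | succ i =>
      have := ih2 (hzpos hx) ⟨i, by simpa using hi, hlt⟩
      omega

/-- The initial left vector (1, 1) has difference 0, so `chainWeight_mono` yields strictness only
once the first cycle has been absorbed. -/
theorem chainWeight_le_lt {n : ℕ} (h k k' : Fin n → ℕ)
    (H : ∀ i, IsPosition (h i) (k i)) (H' : ∀ i, IsPosition (h i) (k' i))
    (hle : ∀ i, cycleWeight (h i) (k i) true true ≤ cycleWeight (h i) (k' i) true true)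
    (hlt : ∃ i : Fin n, 0 < (i : ℕ) ∧ (i : ℕ) + 1 < n ∧
        cycleWeight (h i) (k i) true true < cycleWeight (h i) (k' i) true true)
    (h0 : ∀ i : Fin n, (i : ℕ) = 0 → k i = k' i) :
    chainWeight h k false + chainWeight h k true <
      chainWeight h k' false + chainWeight h k' true := by
  obtain ⟨i, hi, hin, hlt⟩ := hlt
  obtain _ | n := n
  · exact i.elim0
  cases i using Fin.cases with
  | zero => simp at hi
  | succ i =>
  have h1 := cycleWeight_lt (H 0)
  have h2 := cycleWeight_le (h 0) (k 0)
  obtain ⟨z, hz⟩ := Nat.exists_eq_add_of_lt (add_lt_add_of_lt_of_le h1 h2)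
  have := (chainWeight_mono (fun i => h i.succ) (fun i => k i.succ)
      (fun i => k' i.succ) (fun i => H i.succ) (fun i => H' i.succ) (fun i => hle i.succ)
      (cycleWeight (h 0) (k 0) true false + cycleWeight (h 0) (k 0) true true) (z + 1)).2
      (by omega) ⟨i, by simpa using hin, hlt⟩
  rw [← add_assoc, ← hz] at this
  simp only [chainWeight, ← h0 0 rfl]
  rw [cycleWeight_comm _ _ false true] at *
  linarith

/-! ### Extremal positions on one cycle -/

theorem cycleWeight_true_true_one (h : ℕ) : cycleWeight h 1 true true = 0 := by
  simp [cycleWeight]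

theorem cycleWeight_true_true_pos {h k : ℕ} (H : IsPosition h k) (hk : k ≠ 1) :
    0 < cycleWeight h k true true := by
  unfold IsPosition at H
  exact Nat.mul_pos (Nat.fib_pos.2 (by omega)) (Nat.fib_pos.2 (by omega))

theorem cycleWeight_true_true_lt_two {h k : ℕ} (H : IsPosition h k) (H2 : IsPosition h 2)
    (hk : k ≠ 2) : cycleWeight h k true true < cycleWeight h 2 true true := by
  by_cases h1 : k = 1
  · subst h1
    rw [cycleWeight_true_true_one]
    exact cycleWeight_true_true_pos H2 (by norm_num)
  obtain ⟨a, b, hab, hb1, hka, hb, hh⟩ := H.exists_eq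
  obtain ⟨a, rfl⟩ : ∃ c, a = c + 2 := ⟨a - 2, by omega⟩
  obtain ⟨b, rfl⟩ : ∃ c, b = c + 2 := ⟨b - 2, by omega⟩
  simp only [cycleWeight, hb]
  -- For `k ≥ 3` the addition formula splits the entry at position 2 as the entry at `k` plus a
  -- positive product.
  rw [hka, hh, show a + 2 + (b + 2) + 2 - 2 - 1 = (a + 1) + (b + 1) + 1 by omega, Nat.fib_add]
  have : 0 < Nat.fib (a + 1) * Nat.fib (b + 1) :=
    Nat.mul_pos (Nat.fib_pos.2 (by omega)) (Nat.fib_pos.2 (by omega))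
  simp only [Nat.add_sub_cancel]
  norm_num

theorem cycleWeight_true_true_le_two {h k : ℕ} (H : IsPosition h k) (H2 : IsPosition h 2) :
    cycleWeight h k true true ≤ cycleWeight h 2 true true := by
  by_cases hk : k = 2
  · rw [hk]
  · exact (cycleWeight_true_true_lt_two H H2 hk).le

/-! ### Independent sets of one cycle -/

/-- The set contains no two consecutive numbers. -/
def NoConsecutive (S : Finset ℕ) : Prop := ∀ a ∈ S, a + 1 ∉ S

open Classical in
/-- Subsets of `{0, …, m}` without consecutive elements satisfying `Φ`, by membership of `m`. -/
noncomputable def segmentSets (Φ : Finset ℕ → Prop) (m : ℕ) (y : Bool) : Finset (Finset ℕ) :=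
  (Finset.range (m + 1)).powerset.filter
    (fun S => NoConsecutive S ∧ Φ S ∧ (m ∈ S ↔ y = true))

theorem mem_segmentSets {Φ : Finset ℕ → Prop} {m : ℕ} {y : Bool} {S : Finset ℕ} :
    S ∈ segmentSets Φ m y ↔
      S ⊆ Finset.range (m + 1) ∧ NoConsecutive S ∧ Φ S ∧ (m ∈ S ↔ y = true) := by
  simp [segmentSets]

theorem card_segmentSets_succ_false {Φ : Finset ℕ → Prop} {m : ℕ} :
    (segmentSets Φ (m + 1) false).card =
      (segmentSets Φ m false).card + (segmentSets Φ m true).card := by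
  classical
  rw [← Finset.card_union_of_disjoint]
  · congr 1
    ext S
    simp only [Finset.mem_union, mem_segmentSets]
    constructor
    · rintro ⟨h1, h2, h3, h4⟩
      have h5 : S ⊆ Finset.range (m + 1) := by
        intro a ha
        have := Finset.mem_range.1 (h1 ha)
        have : a ≠ m + 1 := by rintro rfl; simp [ha] at h4
        exact Finset.mem_range.2 (by omega)
      by_cases hm : m ∈ S <;> simp [*]
    · rintro (⟨h1, h2, h3, h4⟩ | ⟨h1, h2, h3, h4⟩) <;>
      exact ⟨h1.trans (Finset.range_subset_range.2 (by omega)), h2, h3,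
        by simpa using fun h => absurd (Finset.mem_range.1 (h1 h)) (by omega)⟩
  · rw [Finset.disjoint_left]
    intro S h1 h2
    rw [mem_segmentSets] at h1 h2
    simp [h2.2.2.2] at h1

theorem card_segmentSets_succ_true {Φ : Finset ℕ → Prop} {m : ℕ}
    (hΦ : ∀ S, Φ (insert (m + 1) S) ↔ Φ S) :
    (segmentSets Φ (m + 1) true).card = (segmentSets Φ m false).card := by
  symm
  refine Finset.card_bij (fun S _ => insert (m + 1) S) ?_ ?_ ?_
  · intro S hS
    rw [mem_segmentSets] at hS ⊢
    obtain ⟨h1, h2, h3, h4⟩ := hS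
    have h1' : ∀ a ∈ S, a < m + 1 := fun a ha => Finset.mem_range.1 (h1 ha)
    refine ⟨?_, ?_, (hΦ S).2 h3, by simp⟩
    · intro a ha
      rw [Finset.mem_insert] at ha
      rw [Finset.mem_range]
      rcases ha with rfl | ha
      · omega
      · have := h1' a ha; omega
    · intro a ha ha'
      rw [Finset.mem_insert] at ha ha'
      rcases ha with rfl | ha
      · rcases ha' with h | h
        · omega
        · have := h1' _ h; omega
      · rcases ha' with h | h
        · have : a = m := by omega
          subst this; simp [ha] at h4
        · exact h2 a ha h
  · intro S hS S' hS' h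
    rw [mem_segmentSets] at hS hS'
    have e : m + 1 ∉ S := fun h => absurd (Finset.mem_range.1 (hS.1 h)) (by omega)
    have e' : m + 1 ∉ S' := fun h => absurd (Finset.mem_range.1 (hS'.1 h)) (by omega)
    rw [← Finset.erase_insert e, h, Finset.erase_insert e']
  · intro S hS
    rw [mem_segmentSets] at hS
    obtain ⟨h1, h2, h3, h4⟩ := hS
    have hm : m + 1 ∈ S := by simpa using h4
    refine ⟨S.erase (m + 1), ?_, Finset.insert_erase hm⟩
    rw [mem_segmentSets]
    refine ⟨?_, ?_, ?_, ?_⟩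
    · intro a ha
      rw [Finset.mem_erase] at ha
      have := Finset.mem_range.1 (h1 ha.2)
      rw [Finset.mem_range]; omega
    · intro a ha ha'
      exact h2 a (Finset.mem_of_mem_erase ha) (Finset.mem_of_mem_erase ha')
    · rw [← hΦ, Finset.insert_erase hm]; exact h3
    · have : m ∉ S := fun h => h2 m h hm
      simp [this]

/-- Past `k` the condition `Φ` imposes nothing, so appending vertices gives the Fibonacci
recurrence, started here from the state in which `k` is excluded. -/
theorem card_segmentSets_of_true_empty {Φ : Finset ℕ → Prop} {k : ℕ}
    (hΦ : ∀ m ≥ k, ∀ S, Φ (insert (m + 1) S) ↔ Φ S) (h0 : segmentSets Φ k true = ∅) (j : ℕ) :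
    (segmentSets Φ (k + j) false).card = Nat.fib (j + 1) * (segmentSets Φ k false).card ∧
    (segmentSets Φ (k + j) true).card = Nat.fib j * (segmentSets Φ k false).card := by
  induction j with
  | zero => simp [h0]
  | succ j ih =>
    rw [← add_assoc, card_segmentSets_succ_false, card_segmentSets_succ_true (hΦ _ (by omega)),
      ih.1, ih.2]
    refine ⟨?_, rfl⟩
    rw [show j + 1 + 1 = j + 2 from rfl, Nat.fib_add_two]; ring

/-- When `k` is included, `k + 1` is forced out, so the Fibonacci recurrence starts one vertex
later. -/
theorem card_segmentSets_of_false_empty {Φ : Finset ℕ → Prop} {k : ℕ}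
    (hΦ : ∀ m ≥ k, ∀ S, Φ (insert (m + 1) S) ↔ Φ S) (h0 : segmentSets Φ k false = ∅) (j : ℕ) :
    (segmentSets Φ (k + (j + 1)) false).card = Nat.fib (j + 1) * (segmentSets Φ k true).card ∧
    (segmentSets Φ (k + (j + 1)) true).card = Nat.fib j * (segmentSets Φ k true).card := by
  induction j with
  | zero =>
    rw [zero_add, card_segmentSets_succ_false, card_segmentSets_succ_true (hΦ _ (by omega))]
    simp [h0]
  | succ j ih =>
    rw [← add_assoc k, card_segmentSets_succ_false, card_segmentSets_succ_true (hΦ _ (by omega)),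
      ih.1, ih.2]
    refine ⟨?_, rfl⟩
    rw [show j + 1 + 1 = j + 2 from rfl, Nat.fib_add_two]; ring

/-- The independent sets of a cycle, unrolled on `{0, …, h}` with `0` and `h` identified. -/
def cycleSets (h : ℕ) : Set (Finset ℕ) :=
  {S | S ⊆ Finset.range (h + 1) ∧ NoConsecutive S ∧ (0 ∈ S ↔ h ∈ S)}

theorem card_segmentSets_zero (x y : Bool) :
    (segmentSets (fun S => 0 ∈ S ↔ x = true) 0 y).card = if x = y then 1 else 0 := by
  split_ifs with hxy
  · subst hxy
    rw [Finset.card_eq_one]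
    refine ⟨if x = true then {0} else ∅, ?_⟩
    ext S
    rw [mem_segmentSets, Finset.mem_singleton]
    constructor
    · rintro ⟨h1, -, h3, -⟩
      ext a
      have : a ∈ S → a = 0 := fun h => by simpa using h1 h
      split_ifs with hx
      · simp only [hx, iff_true] at h3
        simp only [Finset.mem_singleton]
        exact ⟨this, fun h => h ▸ h3⟩
      · simp only [hx] at h3
        simp only [Finset.notMem_empty, iff_false]
        intro h
        simpa using h3.1 (this h ▸ h)
    · rintro rfl
      split_ifs with hx <;> simp [hx, NoConsecutive]
  · rw [Finset.card_eq_zero, Finset.eq_empty_iff_forall_notMem]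
    intro S hS
    rw [mem_segmentSets] at hS
    apply hxy
    have := hS.2.2.1.symm.trans hS.2.2.2
    cases x <;> cases y <;> simp_all

theorem card_segmentSets_path (k : ℕ) (x z : Bool) :
    (segmentSets (fun S => 0 ∈ S ↔ x = true) (k + 1) z).card =
      match x, z with
      | false, false => Nat.fib (k + 2)
      | false, true => Nat.fib (k + 1)
      | true, false => Nat.fib (k + 1)
      | true, true => Nat.fib k := by
  have hΦ : ∀ m ≥ 0, ∀ S : Finset ℕ, (0 ∈ insert (m + 1) S ↔ x = true) ↔ (0 ∈ S ↔ x = true) := by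
    intro m _ S; simp
  cases x
  · have h := card_segmentSets_of_true_empty hΦ
      (Finset.card_eq_zero.1 (card_segmentSets_zero false true)) (k + 1)
    rw [card_segmentSets_zero, zero_add] at h
    cases z
    · simpa using h.1
    · simpa using h.2
  · have h := card_segmentSets_of_false_empty hΦ
      (Finset.card_eq_zero.1 (card_segmentSets_zero true false)) k
    rw [card_segmentSets_zero, zero_add] at h
    cases z
    · simpa using h.1
    · simpa using h.2

theorem ncard_cycleSets_eq_cycleWeight {h k : ℕ} (hk : 1 ≤ k) (hkh : k < h) (x z : Bool) :
    {S ∈ cycleSets h | (0 ∈ S ↔ x = true) ∧ (k ∈ S ↔ z = true)}.ncard = cycleWeight h k x z := by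
  obtain ⟨k, rfl⟩ : ∃ c, k = c + 1 := ⟨k - 1, by omega⟩
  obtain ⟨j, rfl⟩ : ∃ c, h = k + 1 + (c + 1) := ⟨h - k - 2, by omega⟩
  set Φ : Finset ℕ → Prop := fun S => (0 ∈ S ↔ x = true) ∧ (k + 1 ∈ S ↔ z = true) with hΦd
  -- The end state at `h` is `x` because `h` is identified with 0. The count then factors through
  -- the state `z` at the second attachment vertex.
  have hset : {S ∈ cycleSets (k + 1 + (j + 1)) | (0 ∈ S ↔ x = true) ∧ (k + 1 ∈ S ↔ z = true)} =
      (segmentSets Φ (k + 1 + (j + 1)) x : Set (Finset ℕ)) := by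
    ext S
    simp only [cycleSets, Set.mem_ofPred_eq, Finset.mem_coe, mem_segmentSets, hΦd]
    tauto
  rw [hset, Set.ncard_coe_finset]
  have hΦ : ∀ m ≥ k + 1, ∀ S, Φ (insert (m + 1) S) ↔ Φ S := by
    intro m hm S
    have : k ≠ m := by omega
    simp [hΦd, this]
  have hbase : segmentSets Φ (k + 1) z = segmentSets (fun S => 0 ∈ S ↔ x = true) (k + 1) z := by
    ext S
    simp only [mem_segmentSets, hΦd]
    tauto
  have hempty : segmentSets Φ (k + 1) (!z) = ∅ := by
    rw [Finset.eq_empty_iff_forall_notMem]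
    intro S hS
    rw [mem_segmentSets] at hS
    have := hS.2.2.1.2.symm.trans hS.2.2.2
    cases z <;> simp at this
  have hs : k + 1 + (j + 1) - (k + 1) = j + 1 := by omega
  cases z
  · have h := card_segmentSets_of_true_empty hΦ hempty (j + 1)
    rw [hbase, card_segmentSets_path] at h
    cases x
    · rw [h.1]; simp only [cycleWeight, hs]; ring
    · rw [h.2]; simp only [cycleWeight, hs]; ring
  · have h := card_segmentSets_of_false_empty hΦ hempty j
    rw [hbase, card_segmentSets_path] at h
    cases x
    · rw [h.1]; simp only [cycleWeight, hs]; ring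
    · rw [h.2]; simp only [cycleWeight, hs, Nat.add_sub_cancel]; ring

theorem finite_cycleSets (h : ℕ) : (cycleSets h).Finite :=
  (Finset.range (h + 1)).powerset.finite_toSet.subset fun _ hS => Finset.mem_coe.2 (Finset.mem_powerset.2 hS.1)

/-! ### Gluing independent sets along a chain -/

/-- Choices of one independent set on each cycle of a chain which agree on the shared vertices,
with prescribed membership of the starting vertex of the first cycle. -/
def chainFamilies {n : ℕ} (h k : Fin n → ℕ) (b : Bool) : Set (Fin n → Finset ℕ) :=
  {S | (∀ i, S i ∈ cycleSets (h i)) ∧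
    (∀ i j : Fin n, (i : ℕ) + 1 = j → (k i ∈ S i ↔ 0 ∈ S j)) ∧
    ∀ i : Fin n, (i : ℕ) = 0 → (0 ∈ S i ↔ b = true)}

theorem finite_chainFamilies {n : ℕ} (h k : Fin n → ℕ) (b : Bool) :
    (chainFamilies h k b).Finite :=
  (Set.Finite.pi' fun i => finite_cycleSets (h i)).subset fun _ hS => hS.1

theorem mem_chainFamilies_succ {n : ℕ} {h k : Fin (n + 1) → ℕ} {b : Bool}
    {S : Fin (n + 1) → Finset ℕ} :
    S ∈ chainFamilies h k b ↔ ∃ y : Bool,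
      S 0 ∈ {S ∈ cycleSets (h 0) | (0 ∈ S ↔ b = true) ∧ (k 0 ∈ S ↔ y = true)} ∧
      (fun i : Fin n => S i.succ) ∈
        chainFamilies (fun i => h i.succ) (fun i => k i.succ) y := by
  constructor
  · rintro ⟨h1, h2, h3⟩
    refine ⟨decide (k 0 ∈ S 0), ⟨h1 0, h3 0 rfl, by simp⟩, fun i => h1 i.succ, ?_, ?_⟩
    · intro i j hij
      exact h2 i.succ j.succ (by simpa using hij)
    · intro i hi
      rw [decide_eq_true_iff]
      exact (h2 0 i.succ (by simp [hi])).symm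
  · rintro ⟨y, ⟨h1, h2, h3⟩, h4, h5, h6⟩
    refine ⟨?_, ?_, ?_⟩
    · intro i
      cases i using Fin.cases with
      | zero => exact h1
      | succ i => exact h4 i
    · intro i j hij
      cases j using Fin.cases with
      | zero => simp at hij
      | succ j =>
        cases i using Fin.cases with
        | zero => exact h3.trans (h6 j (by simpa using hij.symm)).symm
        | succ i => exact h5 i j (by simpa using hij)
    · intro i hi
      obtain rfl : i = 0 := Fin.ext hi
      exact h2

theorem ncard_chainFamilies : ∀ {n : ℕ} (h k : Fin n → ℕ) (_ : ∀ i, 1 ≤ k i ∧ k i < h i)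
    (b : Bool), (chainFamilies h k b).ncard = chainWeight h k b
  | 0, h, k, _, b => by
    have : chainFamilies h k b = {Fin.elim0} := by
      ext S
      simp only [Set.mem_singleton_iff]
      exact ⟨fun _ => funext fun i => i.elim0, fun _ => ⟨fun i => i.elim0, fun i => i.elim0,
        fun i => i.elim0⟩⟩
    rw [this, Set.ncard_singleton]
    rfl
  | n + 1, h, k, H, b => by
    have hpart : ∀ y : Bool, {S : Fin (n + 1) → Finset ℕ | S 0 ∈ {S ∈ cycleSets (h 0) |
          (0 ∈ S ↔ b = true) ∧ (k 0 ∈ S ↔ y = true)} ∧ (fun i : Fin n => S i.succ) ∈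
          chainFamilies (fun i => h i.succ) (fun i => k i.succ) y}.ncard =
        cycleWeight (h 0) (k 0) b y *
          chainWeight (fun i => h i.succ) (fun i => k i.succ) y := by
      intro y
      rw [← ncard_chainFamilies (fun i => h i.succ) (fun i => k i.succ) (fun i => H i.succ) y,
        ← ncard_cycleSets_eq_cycleWeight (H 0).1 (H 0).2 b y, ← Set.ncard_prod]
      refine Set.ncard_congr (fun S _ => (S 0, fun i => S i.succ)) (fun S hS => hS) ?_ ?_
      · intro S S' _ _ hSS
        rw [Prod.mk.injEq] at hSS
        funext i
        cases i using Fin.cases with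
        | zero => exact hSS.1
        | succ i => exact congrFun hSS.2 i
      · rintro ⟨s, S⟩ hS
        exact ⟨Fin.cons s S, hS, by simp⟩
    have hunion : chainFamilies h k b = {S : Fin (n + 1) → Finset ℕ | S 0 ∈ {S ∈ cycleSets (h 0) |
          (0 ∈ S ↔ b = true) ∧ (k 0 ∈ S ↔ false = true)} ∧ (fun i : Fin n => S i.succ) ∈
          chainFamilies (fun i => h i.succ) (fun i => k i.succ) false} ∪
        {S : Fin (n + 1) → Finset ℕ | S 0 ∈ {S ∈ cycleSets (h 0) |
          (0 ∈ S ↔ b = true) ∧ (k 0 ∈ S ↔ true = true)} ∧ (fun i : Fin n => S i.succ) ∈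
          chainFamilies (fun i => h i.succ) (fun i => k i.succ) true} := by
      ext S
      rw [mem_chainFamilies_succ, Bool.exists_bool]
      rfl
    have hfin := finite_chainFamilies h k b
    rw [hunion] at hfin ⊢
    rw [Set.ncard_union_eq _ (hfin.subset Set.subset_union_left)
      (hfin.subset Set.subset_union_right), hpart, hpart]
    · rfl
    · rw [Set.disjoint_left]
      rintro S ⟨⟨-, -, h1⟩, -⟩ ⟨⟨-, -, h2⟩, -⟩
      simp [h2] at h1

/-! ### Labelled chains -/

variable {V : Type*} {G : SimpleGraph V}

/-- The vertices of `G` are labelled so that `G` is a chain of `n` cycles: the `i`-th cycle runs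
through `f i 0, …, f i (h i) = f i 0`, and `f i (k i)` is the first vertex of the next cycle. -/
structure IsChainLabelling (G : SimpleGraph V) {n : ℕ} (h k : Fin n → ℕ) (f : Fin n → ℕ → V) :
    Prop where
  pos_lt : ∀ i, k i < h i
  closed : ∀ i, f i (h i) = f i 0
  surj : ∀ v, ∃ i, ∃ a < h i, f i a = v
  adj_iff : ∀ v w, G.Adj v w ↔ ∃ i, ∃ a < h i, s(f i a, f i (a + 1)) = s(v, w)
  eq_iff : ∀ i j, ∀ a < h i, ∀ b < h j, f i a = f j b ↔
    (i = j ∧ a = b) ∨ ((i : ℕ) + 1 = j ∧ a = k i ∧ b = 0) ∨ ((j : ℕ) + 1 = i ∧ b = k j ∧ a = 0)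

namespace IsChainLabelling

variable {n : ℕ} {h k : Fin n → ℕ} {f : Fin n → ℕ → V}

/-- Coincidences among labels depend only on `h` and `k`, so sending equal labels to equal labels is
well defined. -/
theorem exists_map {W : Type*} {G' : SimpleGraph W} {f' : Fin n → ℕ → W}
    (L : IsChainLabelling G h k f) (L' : IsChainLabelling G' h k f') :
    ∃ e : V → W, ∀ i, ∀ a ≤ h i, e (f i a) = f' i a := by
  choose I A hA hf using L.surj
  have key : ∀ i, ∀ a < h i, f' (I (f i a)) (A (f i a)) = f' i a := by
    intro i a ha
    rw [L'.eq_iff _ _ _ (hA _) _ ha, ← L.eq_iff _ _ _ (hA _) _ ha]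
    exact hf _
  refine ⟨fun v => f' (I v) (A v), fun i a ha => ?_⟩
  rcases ha.lt_or_eq with ha | rfl
  · exact key i a ha
  · rw [L.closed, L'.closed]
    exact key i 0 (by have := L.pos_lt i; omega)

theorem adj_map {W : Type*} {G' : SimpleGraph W} {f' : Fin n → ℕ → W}
    (L : IsChainLabelling G h k f) (L' : IsChainLabelling G' h k f') {e : V → W}
    (he : ∀ i, ∀ a ≤ h i, e (f i a) = f' i a) {v w : V} (hvw : G.Adj v w) :
    G'.Adj (e v) (e w) := by
  obtain ⟨i, a, ha, hs⟩ := (L.adj_iff v w).1 hvw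
  refine (L'.adj_iff _ _).2 ⟨i, a, ha, ?_⟩
  rw [← he i a ha.le, ← he i (a + 1) ha, ← Sym2.map_mk, hs, Sym2.map_mk]

theorem nonempty_iso {W : Type*} {G' : SimpleGraph W} {f' : Fin n → ℕ → W}
    (L : IsChainLabelling G h k f) (L' : IsChainLabelling G' h k f') : Nonempty (G ≃g G') := by
  obtain ⟨e, he⟩ := L.exists_map L'
  obtain ⟨e', he'⟩ := L'.exists_map L
  have l : ∀ v, e' (e v) = v := by
    intro v
    obtain ⟨i, a, ha, rfl⟩ := L.surj v
    rw [he i a ha.le, he' i a ha.le]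
  have r : ∀ v, e (e' v) = v := by
    intro v
    obtain ⟨i, a, ha, rfl⟩ := L'.surj v
    rw [he' i a ha.le, he i a ha.le]
  refine ⟨⟨⟨e, e', l, r⟩, ?_⟩⟩
  intro v w
  refine ⟨fun hvw => ?_, fun hvw => L.adj_map L' he hvw⟩
  have := L'.adj_map L he' hvw
  simpa [l] using this

theorem mem_iff_of_eq (L : IsChainLabelling G h k f) {S : Fin n → Finset ℕ}
    (hS : ∀ i, S i ∈ cycleSets (h i))
    (hc : ∀ i j : Fin n, (i : ℕ) + 1 = j → (k i ∈ S i ↔ 0 ∈ S j)) {i j : Fin n} {a b : ℕ}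
    (ha : a ≤ h i) (hb : b ≤ h j) (hab : f i a = f j b) : a ∈ S i ↔ b ∈ S j := by
  have red : ∀ i, ∀ a ≤ h i, ∃ a' < h i, f i a' = f i a ∧ (a' ∈ S i ↔ a ∈ S i) := by
    intro i a ha
    rcases ha.lt_or_eq with ha | rfl
    · exact ⟨a, ha, rfl, Iff.rfl⟩
    · exact ⟨0, by have := L.pos_lt i; omega, (L.closed i).symm, (hS i).2.2⟩
  obtain ⟨a', ha', hfa, haS⟩ := red i a ha
  obtain ⟨b', hb', hfb, hbS⟩ := red j b hb
  rw [← haS, ← hbS]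
  rw [← hfa, ← hfb, L.eq_iff _ _ _ ha' _ hb'] at hab
  rcases hab with ⟨rfl, rfl⟩ | ⟨hij, rfl, rfl⟩ | ⟨hij, rfl, rfl⟩
  · rfl
  · exact hc i j hij
  · exact (hc j i hij).symm

/-- Pulling an independent set back along each `f i` gives a compatible family, and every compatible
family glues. For an empty chain there would be no starting vertex to separate the two summands. -/
theorem numIndepSets_eq (L : IsChainLabelling G h k f) (hk : ∀ i, 1 ≤ k i) (hn : 0 < n) :
    numIndepSets G = chainWeight h k false + chainWeight h k true := by
  classical
  have hkh : ∀ i, 1 ≤ k i ∧ k i < h i := fun i => ⟨hk i, L.pos_lt i⟩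
  rw [← ncard_chainFamilies h k hkh, ← ncard_chainFamilies h k hkh, ← Set.ncard_union_eq _
    (finite_chainFamilies _ _ _) (finite_chainFamilies _ _ _)]
  swap
  · rw [Set.disjoint_left]
    rintro S ⟨-, -, h1⟩ ⟨-, -, h2⟩
    have h1 := h1 ⟨0, hn⟩ rfl
    simp [h2 ⟨0, hn⟩ rfl] at h1
  have hun : ∀ S, S ∈ chainFamilies h k false ∪ chainFamilies h k true ↔
      (∀ i, S i ∈ cycleSets (h i)) ∧
      ∀ i j : Fin n, (i : ℕ) + 1 = j → (k i ∈ S i ↔ 0 ∈ S j) := by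
    intro S
    constructor
    · rintro (⟨h1, h2, -⟩ | ⟨h1, h2, -⟩) <;> exact ⟨h1, h2⟩
    · rintro ⟨h1, h2⟩
      by_cases h0 : 0 ∈ S ⟨0, hn⟩
      · refine Or.inr ⟨h1, h2, fun i hi => ?_⟩
        obtain rfl : i = ⟨0, hn⟩ := Fin.ext hi
        simp [h0]
      · refine Or.inl ⟨h1, h2, fun i hi => ?_⟩
        obtain rfl : i = ⟨0, hn⟩ := Fin.ext hi
        simp [h0]
  refine Set.ncard_congr (fun S _ i => (Finset.range (h i + 1)).filter (fun a => f i a ∈ S))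
    ?_ ?_ ?_
  · intro S hS
    rw [hun]
    have h0 : ∀ i, 0 < h i := fun i => (Nat.zero_le _).trans_lt (L.pos_lt i)
    refine ⟨fun i => ⟨Finset.filter_subset _ _, ?_, ?_⟩, ?_⟩
    · intro a ha ha'
      rw [Finset.mem_filter, Finset.mem_range] at ha ha'
      have hadj : G.Adj (f i a) (f i (a + 1)) :=
        (L.adj_iff _ _).2 ⟨i, a, by omega, rfl⟩
      exact hS ha.2 ha'.2 hadj.ne hadj
    · simp [L.closed]
    · intro i j hij
      have := L.pos_lt i
      have he : f i (k i) = f j 0 := (L.eq_iff i j _ this _ (h0 j)).2 (Or.inr (Or.inl ⟨hij, rfl, rfl⟩))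
      simp [he, this.trans (Nat.lt_succ_self _)]
  · intro S S' _ _ hSS
    ext v
    obtain ⟨i, a, ha, rfl⟩ := L.surj v
    have := congrArg (fun T => a ∈ T) (congrFun hSS i)
    simpa [ha.trans (Nat.lt_succ_self _)] using this
  · intro S hS
    rw [hun] at hS
    obtain ⟨h1, h2⟩ := hS
    have hmem : ∀ i, ∀ a ≤ h i, f i a ∈ {v | ∃ j, ∃ b ≤ h j, b ∈ S j ∧ f j b = v} ↔ a ∈ S i := by
      intro i a ha
      constructor
      · rintro ⟨j, b, hb, hbS, hfb⟩
        exact (L.mem_iff_of_eq h1 h2 hb ha hfb).1 hbS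
      · intro haS
        exact ⟨i, a, ha, haS, rfl⟩
    refine ⟨{v | ∃ j, ∃ b ≤ h j, b ∈ S j ∧ f j b = v}, ?_, ?_⟩
    · intro v hv w hw _ hadj
      obtain ⟨i, a, ha, hs⟩ := (L.adj_iff _ _).1 hadj
      have haa : f i a ∈ {v | ∃ j, ∃ b ≤ h j, b ∈ S j ∧ f j b = v} ∧
          f i (a + 1) ∈ {v | ∃ j, ∃ b ≤ h j, b ∈ S j ∧ f j b = v} := by
        rw [Sym2.eq_iff] at hs
        rcases hs with ⟨e1, e2⟩ | ⟨e1, e2⟩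
        · rw [e1, e2]; exact ⟨hv, hw⟩
        · rw [e1, e2]; exact ⟨hw, hv⟩
      rw [hmem _ _ ha.le, hmem _ _ ha] at haa
      exact (h1 i).2.1 a haa.1 haa.2
    · funext i
      ext a
      simp only [Finset.mem_filter, Finset.mem_range]
      constructor
      · rintro ⟨ha, hfa⟩
        exact (hmem i a (by omega)).1 hfa
      · intro ha
        have := Finset.mem_range.1 ((h1 i).1 ha)
        exact ⟨this, (hmem i a (by omega)).2 ha⟩

end IsChainLabelling

/-! ### Labelling one cycle -/

/-- `f 0, …, f h = f 0` runs once around the cycle `H`. -/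
structure IsCycleLabelling (H : G.Subgraph) (h : ℕ) (f : ℕ → V) : Prop where
  three_le : 3 ≤ h
  closed : f h = f 0
  inj : ∀ a < h, ∀ b < h, f a = f b → a = b
  mem_iff : ∀ v, v ∈ H.verts ↔ ∃ a < h, f a = v
  adj_iff : ∀ v w, H.Adj v w ↔ ∃ a < h, s(f a, f (a + 1)) = s(v, w)

theorem IsCycleSubgraph.exists_labelling {H : G.Subgraph} (hH : IsCycleSubgraph H) {u : V}
    (hu : u ∈ H.verts) : ∃ f, IsCycleLabelling H H.verts.ncard f ∧ f 0 = u := by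
  classical
  obtain ⟨v, c, hc, rfl⟩ := hH
  rw [SimpleGraph.Walk.mem_verts_toSubgraph] at hu
  have hd := hc.rotate hu
  rw [← SimpleGraph.Walk.toSubgraph_rotate c hu]
  generalize c.rotate u hu = d at hd
  have hinj : ∀ a < d.length, ∀ b < d.length, d.getVert a = d.getVert b → a = b := by
    intro a ha b hb hab
    exact hd.getVert_injOn' (by simp only [Set.mem_ofPred_eq]; omega)
      (by simp only [Set.mem_ofPred_eq]; omega) hab
  have hlen := hd.three_le_length
  have hmem : ∀ v, v ∈ d.toSubgraph.verts ↔ ∃ a < d.length, d.getVert a = v := by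
    intro v
    rw [SimpleGraph.Walk.mem_verts_toSubgraph, SimpleGraph.Walk.mem_support_iff_exists_getVert]
    constructor
    · rintro ⟨a, rfl, ha⟩
      rcases ha.lt_or_eq with ha | rfl
      · exact ⟨a, ha, rfl⟩
      · exact ⟨0, by omega, by simp⟩
    · rintro ⟨a, ha, rfl⟩
      exact ⟨a, rfl, ha.le⟩
  have hcard : d.toSubgraph.verts.ncard = d.length := by
    have : d.toSubgraph.verts = d.getVert '' (Finset.range d.length : Set ℕ) := by
      ext v
      rw [hmem]
      simp
    rw [this, Set.InjOn.ncard_image, Set.ncard_coe_finset, Finset.card_range]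
    intro a ha b hb hab
    exact hinj a (by simpa using ha) b (by simpa using hb) hab
  refine ⟨d.getVert, ?_, by simp⟩
  rw [hcard]
  refine ⟨hlen, by simp, hinj, hmem, fun v w => ?_⟩
  rw [SimpleGraph.Walk.toSubgraph_adj_iff]
  exact exists_congr fun a => and_comm

namespace IsCycleLabelling

variable {H : G.Subgraph} {h : ℕ} {f : ℕ → V}

/-- Changing the direction of travel turns position `a` into `h - a`, so a position can be
normalised to at most half the length. -/
theorem reverse (L : IsCycleLabelling H h f) : IsCycleLabelling H h (fun a => f (h - a)) := by
  have h3 := L.three_le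
  have hcl := L.closed
  refine ⟨h3, by simp [hcl], ?_, ?_, ?_⟩
  · intro a ha b hb hab
    have red : ∀ a < h, ∃ a' < h, f a' = f (h - a) ∧ ((a = 0 ∧ a' = 0) ∨ (a ≠ 0 ∧ a' = h - a)) := by
      intro a ha
      by_cases h0 : a = 0
      · exact ⟨0, by omega, by rw [h0, Nat.sub_zero, hcl], by simp [h0]⟩
      · exact ⟨h - a, by omega, rfl, by simp [h0]⟩
    obtain ⟨a', ha', e1, r1⟩ := red a ha
    obtain ⟨b', hb', e2, r2⟩ := red b hb
    have := L.inj a' ha' b' hb' (by rw [e1, e2]; exact hab)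
    omega
  · intro v
    rw [L.mem_iff]
    constructor
    · rintro ⟨a, ha, rfl⟩
      by_cases h0 : a = 0
      · exact ⟨0, by omega, by simp [h0, hcl]⟩
      · exact ⟨h - a, by omega, by rw [Nat.sub_sub_self ha.le]⟩
    · rintro ⟨a, ha, rfl⟩
      by_cases h0 : a = 0
      · exact ⟨0, by omega, by simp [h0, hcl]⟩
      · exact ⟨h - a, by omega, rfl⟩
  · intro v w
    rw [L.adj_iff]
    constructor
    · rintro ⟨a, ha, e⟩
      refine ⟨h - 1 - a, by omega, ?_⟩
      rw [← e, Sym2.eq_swap, show h - (h - 1 - a + 1) = a by omega,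
        show h - (h - 1 - a) = a + 1 by omega]
    · rintro ⟨a, ha, e⟩
      refine ⟨h - 1 - a, by omega, ?_⟩
      rw [← e, Sym2.eq_swap, show h - (a + 1) = h - 1 - a by omega,
        show h - a = h - 1 - a + 1 by omega]

theorem mem (L : IsCycleLabelling H h f) {a : ℕ} (ha : a < h) : f a ∈ H.verts :=
  (L.mem_iff _).2 ⟨a, ha, rfl⟩

theorem adj_succ (L : IsCycleLabelling H h f) {a : ℕ} (ha : a < h) : H.Adj (f a) (f (a + 1)) :=
  (L.adj_iff _ _).2 ⟨a, ha, rfl⟩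

theorem adj_cases (L : IsCycleLabelling H h f) {a b : ℕ} (ha : a < h) (hb : b < h)
    (hab : H.Adj (f a) (f b)) :
    b = a + 1 ∨ a = b + 1 ∨ (a = 0 ∧ b + 1 = h) ∨ (b = 0 ∧ a + 1 = h) := by
  obtain ⟨c, hc, e⟩ := (L.adj_iff _ _).1 hab
  have red : ∀ b < h, f (c + 1) = f b → b = c + 1 ∨ (b = 0 ∧ c + 1 = h) := by
    intro b hb e
    rcases Nat.lt_or_ge (c + 1) h with h1 | h1
    · exact Or.inl (L.inj _ hb _ h1 e.symm)
    · have h2 : c + 1 = h := by omega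
      rw [h2, L.closed] at e
      exact Or.inr ⟨(L.inj _ (by omega) _ hb e).symm, h2⟩
  rw [Sym2.eq_iff] at e
  rcases e with ⟨e1, e2⟩ | ⟨e1, e2⟩
  · have := L.inj _ hc _ ha e1
    have := red b hb e2
    omega
  · have := L.inj _ hc _ hb e1
    have := red a ha e2
    omega

theorem eq_one_of_adj (L : IsCycleLabelling H h f) {k : ℕ} (hk : IsPosition h k)
    (hadj : H.Adj (f 0) (f k)) : k = 1 := by
  unfold IsPosition at hk
  have := L.adj_cases (by omega) (by omega) hadj
  omega

theorem eq_two_of_adj_of_adj (L : IsCycleLabelling H h f) {k : ℕ} (hk : IsPosition h k)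
    (hk1 : k ≠ 1) {w : V} (h1 : H.Adj (f 0) w) (h2 : H.Adj w (f k)) : k = 2 := by
  unfold IsPosition at hk
  obtain ⟨a, ha, rfl⟩ := (L.mem_iff w).1 (H.edge_vert h2)
  have := L.adj_cases (by omega) ha h1
  have := L.adj_cases ha (by omega) h2
  omega

end IsCycleLabelling

theorem IsCycleSubgraph.exists_labelling_pair {H : G.Subgraph} (hH : IsCycleSubgraph H) {u v : V}
    (hu : u ∈ H.verts) (hv : v ∈ H.verts) (huv : u ≠ v) :
    ∃ f k, IsCycleLabelling H H.verts.ncard f ∧ f 0 = u ∧ f k = v ∧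
      IsPosition H.verts.ncard k := by
  obtain ⟨f, L, hf⟩ := hH.exists_labelling hu
  obtain ⟨a, ha, rfl⟩ := (L.mem_iff v).1 hv
  have h0 : a ≠ 0 := by rintro rfl; exact huv hf.symm
  have h3 := L.three_le
  by_cases h2 : 2 * a ≤ H.verts.ncard
  · exact ⟨f, a, L, hf, rfl, by omega, h2, h3⟩
  · refine ⟨_, H.verts.ncard - a, L.reverse, ?_, ?_, by omega, by omega, h3⟩
    · simp [L.closed, hf]
    · simp [Nat.sub_sub_self ha.le]

theorem IsCycleSubgraph.exists_adj {H : G.Subgraph} (hH : IsCycleSubgraph H) {u : V}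
    (hu : u ∈ H.verts) : ∃ w, H.Adj u w := by
  obtain ⟨f, L, rfl⟩ := hH.exists_labelling hu
  exact ⟨_, L.adj_succ (by have := L.three_le; omega)⟩

theorem IsCycleSubgraph.nonempty {H : G.Subgraph} (hH : IsCycleSubgraph H) : H.verts.Nonempty := by
  obtain ⟨v, c, -, rfl⟩ := hH
  exact ⟨v, c.start_mem_verts_toSubgraph⟩

theorem IsCycleSubgraph.connected {H : G.Subgraph} (hH : IsCycleSubgraph H) : H.Connected := by
  obtain ⟨v, c, -, rfl⟩ := hH
  exact c.toSubgraph_connected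

/-! ### Blocks and intersections of cycles -/

/-- Any two vertices of `H` are joined in `H` avoiding any given third vertex. -/
def JoinedAvoiding (H : G.Subgraph) : Prop :=
  ∀ w, ∀ x ∈ H.verts, ∀ y ∈ H.verts, x ≠ w → y ≠ w →
    Relation.ReflTransGen (fun a b => H.Adj a b ∧ a ≠ w ∧ b ≠ w) x y

theorem JoinedAvoiding.not_isCutVertex {H : G.Subgraph} (hH : JoinedAvoiding H) (v : H.verts) :
    ¬ IsCutVertex H.coe v := by
  unfold IsCutVertex
  rw [not_not]
  rintro ⟨⟨x, hx⟩, hxv⟩ ⟨⟨y, hy⟩, hyv⟩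
  have hxv' : x ≠ v := fun h => hxv (Subtype.ext h)
  have hyv' : y ≠ v := fun h => hyv (Subtype.ext h)
  have := hH v x hx y hy hxv' hyv'
  induction this with
  | refl => exact SimpleGraph.Reachable.refl _
  | tail _ hbc ih =>
    obtain ⟨hadj, hb, hc⟩ := hbc
    refine (ih (H.edge_vert hadj) (fun h => hb (congrArg Subtype.val h)) hb).trans ?_
    exact SimpleGraph.Adj.reachable hadj

theorem IsCycleSubgraph.joinedAvoiding {H : G.Subgraph} (hH : IsCycleSubgraph H) :
    JoinedAvoiding H := by
  intro w
  -- Starting the labelling at `w` if `w` lies on the cycle makes the path `f 1, …, f (h - 1)` avoid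
  -- `w`.
  obtain ⟨u, hu, huw⟩ : ∃ u ∈ H.verts, w ∈ H.verts → u = w := by
    by_cases hw : w ∈ H.verts
    · exact ⟨w, hw, fun _ => rfl⟩
    · exact ⟨_, hH.nonempty.some_mem, fun h => absurd h hw⟩
  obtain ⟨f, L, rfl⟩ := hH.exists_labelling hu
  have h3 := L.three_le
  have hne : ∀ a, 1 ≤ a → a < H.verts.ncard → f a ≠ w := by
    rintro a ha ha' rfl
    have := L.inj _ (by omega) _ ha' (huw (L.mem ha'))
    omega
  have hsymm : Std.Symm (fun a b => H.Adj a b ∧ a ≠ w ∧ b ≠ w) :=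
    ⟨fun a b ⟨h1, h2, h3⟩ => ⟨h1.symm, h3, h2⟩⟩
  have key : ∀ x ∈ H.verts, x ≠ w →
      Relation.ReflTransGen (fun a b => H.Adj a b ∧ a ≠ w ∧ b ≠ w) (f 1) x := by
    intro x hx hxw
    obtain ⟨a, ha, rfl⟩ := (L.mem_iff x).1 hx
    rcases Nat.eq_zero_or_pos a with rfl | h1
    · exact Relation.ReflTransGen.single
        ⟨(L.adj_succ (a := 0) (by omega)).symm, hne 1 le_rfl (by omega), hxw⟩
    · clear hx hxw
      induction a, h1 using Nat.le_induction with
      | base => exact Relation.ReflTransGen.refl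
      | succ b hb ih =>
        exact (ih (by omega)).tail ⟨L.adj_succ (by omega), hne b hb (by omega), hne _ (by omega) ha⟩
  intro x hx y hy hxw hyw
  exact (Relation.ReflTransGen.stdSymm.symm _ _ (key x hx hxw)).trans (key y hy hyw)

/-- Of two common vertices at least one survives the deletion of `w`, and every remaining vertex can
be joined to it. -/
theorem JoinedAvoiding.sup {C D : G.Subgraph} (hC : JoinedAvoiding C) (hD : JoinedAvoiding D)
    {p q : V} (hp : p ∈ C.verts ∩ D.verts) (hq : q ∈ C.verts ∩ D.verts) (hpq : p ≠ q) :
    JoinedAvoiding (C ⊔ D) := by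
  intro w
  obtain ⟨s, hs, hsw⟩ : ∃ s ∈ C.verts ∩ D.verts, s ≠ w := by
    by_cases h : p = w
    · exact ⟨q, hq, fun h' => hpq (h.trans h'.symm)⟩
    · exact ⟨p, hp, h⟩
  have hsymm : Std.Symm (fun a b => (C ⊔ D).Adj a b ∧ a ≠ w ∧ b ≠ w) :=
    ⟨fun a b ⟨h1, h2, h3⟩ => ⟨h1.symm, h3, h2⟩⟩
  have key : ∀ x ∈ (C ⊔ D).verts, x ≠ w →
      Relation.ReflTransGen (fun a b => (C ⊔ D).Adj a b ∧ a ≠ w ∧ b ≠ w) s x := by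
    rintro x (hx | hx) hxw
    · exact Relation.ReflTransGen.mono (fun a b h => ⟨Or.inl h.1, h.2⟩) _ _
        (hC w s hs.1 x hx hsw hxw)
    · exact Relation.ReflTransGen.mono (fun a b h => ⟨Or.inr h.1, h.2⟩) _ _
        (hD w s hs.2 x hx hsw hxw)
  intro x hx y hy hxw hyw
  exact (Relation.ReflTransGen.stdSymm.symm _ _ (key x hx hxw)).trans (key y hy hyw)

theorem joinedAvoiding_subgraphOfAdj {v w : V} (hvw : G.Adj v w) :
    JoinedAvoiding (G.subgraphOfAdj hvw) := by
  intro z x hx y hy hxz hyz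
  by_cases hxy : x = y
  · rw [hxy]
  · refine Relation.ReflTransGen.single ⟨?_, hxz, hyz⟩
    simp only [SimpleGraph.subgraphOfAdj_verts, Set.mem_insert_iff, Set.mem_singleton_iff] at hx hy
    rw [SimpleGraph.subgraphOfAdj_adj, Sym2.eq_iff]
    rcases hx with rfl | rfl <;> rcases hy with rfl | rfl <;> simp_all

theorem exists_isBlock_ge [Finite V] {H : G.Subgraph} (hc : H.Connected)
    (hH : ∀ v, ¬ IsCutVertex H.coe v) : ∃ B : G.Subgraph, IsBlock B ∧ H ≤ B := by
  obtain ⟨B, hle, hB⟩ := Finite.exists_le_maximal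
    (p := fun H : G.Subgraph => H.Connected ∧ ∀ v, ¬ IsCutVertex H.coe v) ⟨hc, hH⟩
  exact ⟨B, hB, hle⟩

theorem IsChainCactus.isCycleSubgraph_of_isBlock (hG : IsChainCactus G) {v w : V}
    (hvw : G.Adj v w) {B : G.Subgraph} (hB : IsBlock B) : IsCycleSubgraph B := by
  rcases hG.2 with h1 | h
  · obtain ⟨hs, -⟩ := Nat.card_eq_one_iff_unique.1 h1
    exact absurd (Subsingleton.elim v w) hvw.ne
  · exact (h.1 B hB).1

theorem IsChainCactus.exists_cycle_of_adj [Finite V] (hG : IsChainCactus G) {v w : V}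
    (hvw : G.Adj v w) : ∃ B : G.Subgraph, IsCycleSubgraph B ∧ B.Adj v w := by
  obtain ⟨B, hB, hle⟩ := exists_isBlock_ge (SimpleGraph.Subgraph.subgraphOfAdj_connected hvw)
    (joinedAvoiding_subgraphOfAdj hvw).not_isCutVertex
  exact ⟨B, hG.isCycleSubgraph_of_isBlock hvw hB, hle.2 (by simp)⟩

/-- With two common vertices, `C ⊔ D` would lie in one block, itself a cycle; it shares an edge with
each of `C` and `D`, so the cactus condition makes all three equal. -/
theorem IsChainCactus.eq_of_mem_of_mem [Finite V] (hG : IsChainCactus G) {C D : G.Subgraph}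
    (hC : IsCycleSubgraph C) (hD : IsCycleSubgraph D) (hCD : C ≠ D) {p q : V}
    (hpC : p ∈ C.verts) (hpD : p ∈ D.verts) (hqC : q ∈ C.verts) (hqD : q ∈ D.verts) : p = q := by
  by_contra hpq
  obtain ⟨w, hw⟩ := hC.exists_adj hpC
  obtain ⟨z, hz⟩ := hD.exists_adj hpD
  obtain ⟨B, hB, hle⟩ := exists_isBlock_ge
    (SimpleGraph.Subgraph.connected_sup hC.connected.preconnected hD.connected.preconnected
      ⟨p, hpC, hpD⟩)
    (hC.joinedAvoiding.sup hD.joinedAvoiding ⟨hpC, hpD⟩ ⟨hqC, hqD⟩ hpq).not_isCutVertex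
  have hB' := hG.isCycleSubgraph_of_isBlock (C.adj_sub hw) hB
  apply hCD
  rw [hG.1.2 C B hC hB' s(p, w) hw (hle.2 (Or.inl hw)),
    hG.1.2 D B hD hB' s(p, z) hz (hle.2 (Or.inr hz))]

/-- The two cut vertices witnessing the position are distinct, so they must be `s` and `e` in some
order, and distance is symmetric. -/
theorem InPosition.exists_of_cutVertices {C : G.Subgraph} {m : ℕ} (hC : InPosition C m) {s e : V}
    (hcut : ∀ x ∈ C.verts, IsCutVertex G x → x = s ∨ x = e) :
    ∃ u v : C.verts, (u : V) = s ∧ (v : V) = e ∧ C.coe.dist u v = m := by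
  obtain ⟨u, v, huv, hu, hv, hd⟩ := hC
  have huv' : (u : V) ≠ v := fun h => huv (Subtype.ext h)
  rcases hcut u u.2 hu with h1 | h1 <;> rcases hcut v v.2 hv with h2 | h2
  · exact absurd (h1.trans h2.symm) huv'
  · exact ⟨u, v, h1, h2, hd⟩
  · exact ⟨v, u, h2, h1, by rw [SimpleGraph.dist_comm, hd]⟩
  · exact absurd (h1.trans h2.symm) huv'

/-! ### Labelling a chain cactus -/

namespace IsChainCactusWith

variable {n : ℕ} {C : Fin n → G.Subgraph}

theorem isCycleSubgraph (hC : IsChainCactusWith G C) (i : Fin n) : IsCycleSubgraph (C i) := by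
  have : C i ∈ Set.range C := ⟨i, rfl⟩
  rwa [hC.range_eq] at this

theorem exists_eq (hC : IsChainCactusWith G C) {H : G.Subgraph} (hH : IsCycleSubgraph H) :
    ∃ i, C i = H := by
  have : H ∈ {H : G.Subgraph | IsCycleSubgraph H} := hH
  rwa [← hC.range_eq] at this

theorem eq_of_mem_of_mem [Finite V] (hC : IsChainCactusWith G C) {i j : Fin n} (hij : i ≠ j)
    {p q : V} (hpi : p ∈ (C i).verts) (hpj : p ∈ (C j).verts) (hqi : q ∈ (C i).verts)
    (hqj : q ∈ (C j).verts) : p = q :=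
  hC.isChainCactus.eq_of_mem_of_mem (hC.isCycleSubgraph i) (hC.isCycleSubgraph j)
    (fun h => hij (hC.injective h)) hpi hpj hqi hqj

theorem consecutive_of_mem (hC : IsChainCactusWith G C) {i j : Fin n} (hij : i ≠ j)
    {p : V} (hpi : p ∈ (C i).verts) (hpj : p ∈ (C j).verts) : (i : ℕ) + 1 = j ∨ (j : ℕ) + 1 = i :=
  (hC.meet_iff i j hij).1 ⟨p, hpi, hpj⟩

theorem adj_iff [Finite V] (hC : IsChainCactusWith G C) (v w : V) :
    G.Adj v w ↔ ∃ i, (C i).Adj v w := by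
  constructor
  · intro hvw
    obtain ⟨B, hB, hadj⟩ := hC.isChainCactus.exists_cycle_of_adj hvw
    obtain ⟨i, rfl⟩ := hC.exists_eq hB
    exact ⟨i, hadj⟩
  · rintro ⟨i, h⟩
    exact (C i).adj_sub h

theorem exists_mem_verts [Finite V] (hC : IsChainCactusWith G C) (hn : 0 < n) (v : V) :
    ∃ i, v ∈ (C i).verts := by
  have h0 := hC.isCycleSubgraph ⟨0, hn⟩
  obtain ⟨a, ha⟩ := h0.nonempty
  by_cases hav : v = a
  · exact ⟨_, hav ▸ ha⟩
  obtain ⟨p⟩ := hC.isChainCactus.1.1.preconnected v a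
  cases p with
  | nil => exact absurd rfl hav
  | cons h p =>
    obtain ⟨i, hi⟩ := (hC.adj_iff _ _).1 h
    exact ⟨i, (C i).edge_vert hi⟩

theorem card_eq_one [Finite V] (hC : IsChainCactusWith G C) (hn : n = 0) : Nat.card V = 1 := by
  subst hn
  have hconn := hC.isChainCactus.1.1
  obtain ⟨v⟩ := hconn.nonempty
  refine Nat.card_eq_one_iff_unique.2 ⟨⟨fun x y => ?_⟩, ⟨v⟩⟩
  by_contra hxy
  obtain ⟨p⟩ := hconn.preconnected x y
  cases p with
  | nil => exact hxy rfl
  | cons h p =>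
    obtain ⟨i, -⟩ := (hC.adj_iff _ _).1 h
    exact i.elim0

/-- On each cycle a starting and an end vertex, the end vertex being the starting vertex of the next
cycle, and adjacent on the first and the last cycle. -/
theorem exists_start_end [Finite V] (hC : IsChainCactusWith G C) :
    ∃ s e : Fin n → V, (∀ i, s i ∈ (C i).verts) ∧ (∀ i, e i ∈ (C i).verts) ∧
      (∀ i j : Fin n, (i : ℕ) + 1 = j → e i = s j) ∧ (∀ i, s i ≠ e i) ∧
      ∀ i : Fin n, (i : ℕ) = 0 ∨ (i : ℕ) + 1 = n → (C i).Adj (s i) (e i) := by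
  have hu : ∀ i : Fin n, ∃ u ∈ (C i).verts, ∀ j : Fin n, (i : ℕ) + 1 = j → u ∈ (C j).verts := by
    intro i
    by_cases hi : (i : ℕ) + 1 < n
    · obtain ⟨u, hu1, hu2⟩ := (hC.meet_iff i ⟨i + 1, hi⟩
        (fun h => by simpa using congrArg Fin.val h)).2 (Or.inl rfl)
      refine ⟨u, hu1, fun j hj => ?_⟩
      obtain rfl : (⟨i + 1, hi⟩ : Fin n) = j := Fin.ext hj
      exact hu2
    · obtain ⟨u, hu⟩ := (hC.isCycleSubgraph i).nonempty
      exact ⟨u, hu, fun j hj => absurd j.2 (by omega)⟩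
  choose u hu1 hu2 using hu
  have hs : ∀ j : Fin n, ∃ s ∈ (C j).verts, (∀ i : Fin n, (i : ℕ) + 1 = j → u i = s) ∧
      ((j : ℕ) = 0 → (C j).Adj s (u j)) := by
    intro j
    by_cases hj : (j : ℕ) = 0
    · obtain ⟨w, hw⟩ := (hC.isCycleSubgraph j).exists_adj (hu1 j)
      exact ⟨w, (C j).edge_vert hw.symm, fun i hi => by omega, fun _ => hw.symm⟩
    · refine ⟨u ⟨j - 1, by omega⟩, hu2 _ _ (by simp; omega), fun i hi => ?_, fun h => absurd h hj⟩
      congr 1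
      exact Fin.ext (by simp; omega)
  choose s hs1 hs2 hs3 using hs
  have he : ∀ i : Fin n, ∃ e ∈ (C i).verts, ((i : ℕ) + 1 < n → e = u i) ∧
      ((i : ℕ) + 1 = n → (C i).Adj (s i) e) := by
    intro i
    by_cases hi : (i : ℕ) + 1 < n
    · exact ⟨u i, hu1 i, fun _ => rfl, fun h => by omega⟩
    · obtain ⟨w, hw⟩ := (hC.isCycleSubgraph i).exists_adj (hs1 i)
      exact ⟨w, (C i).edge_vert hw.symm, fun h => absurd h hi, fun _ => hw⟩
  choose e he1 he2 he3 using he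
  have hadj : ∀ i : Fin n, (i : ℕ) = 0 ∨ (i : ℕ) + 1 = n → (C i).Adj (s i) (e i) := by
    intro i hi
    by_cases hn : (i : ℕ) + 1 = n
    · exact he3 i hn
    · rw [he2 i (by omega)]
      exact hs3 i (by omega)
  refine ⟨s, e, hs1, he1, fun i j hij => ?_, fun i => ?_, hadj⟩
  · rw [he2 i (by omega), hs2 j i hij]
  · by_cases hi : (i : ℕ) = 0 ∨ (i : ℕ) + 1 = n
    · exact (hadj i hi).ne
    · push Not at hi
      intro hse
      -- If start and end coincided on an internal cycle, its two neighbours in the chain would meet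
      -- without being consecutive.
      let p : Fin n := ⟨i - 1, by omega⟩
      let q : Fin n := ⟨i + 1, by omega⟩
      have h1 : s i ∈ (C p).verts := by
        rw [← hs2 i p (by simp only [p]; omega)]
        exact hu1 p
      have h2 : s i ∈ (C q).verts := by
        rw [hse, he2 i (by omega)]
        exact hu2 i q rfl
      have hpq : p ≠ q := fun h => by
        have := congrArg Fin.val h
        simp only [p, q] at this
        omega
      have := hC.consecutive_of_mem hpq h1 h2
      simp only [p, q] at this
      omega

theorem exists_mem_of_isCutVertex (hC : IsChainCactusWith G C) {i : Fin n} {x : V}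
    (hx : x ∈ (C i).verts) (hcut : IsCutVertex G x) : ∃ j, j ≠ i ∧ x ∈ (C j).verts := by
  obtain ⟨w, hw⟩ := (hC.isCycleSubgraph i).exists_adj hx
  rcases hC.isChainCactus.2 with h1 | ⟨-, h2⟩
  · obtain ⟨hs, -⟩ := Nat.card_eq_one_iff_unique.1 h1
    exact absurd (Subsingleton.elim x w) hw.ne
  · have h := h2 x hcut
    rw [Set.encard_eq_two] at h
    obtain ⟨D, E, hDE, hset⟩ := h
    obtain ⟨F, hF, hFi⟩ : ∃ F ∈ ({D, E} : Set G.Subgraph), F ≠ C i := by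
      by_cases hD : D = C i
      · exact ⟨E, by simp, fun h => hDE (hD.trans h.symm)⟩
      · exact ⟨D, by simp, hD⟩
    rw [← hset] at hF
    obtain ⟨j, rfl⟩ := hC.exists_eq hF.1
    exact ⟨j, fun h => hFi (h ▸ rfl), hF.2⟩

theorem exists_labelling [Finite V] (hC : IsChainCactusWith G C) (hn : 0 < n) :
    ∃ k f, IsChainLabelling G (fun i => (C i).verts.ncard) k f ∧
      (∀ i, IsPosition (C i).verts.ncard (k i)) ∧
      (∀ i : Fin n, (i : ℕ) = 0 ∨ (i : ℕ) + 1 = n → k i = 1) ∧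
      (∀ i : Fin n, 0 < (i : ℕ) → (i : ℕ) + 1 < n → InPosition (C i) 1 → k i = 1) ∧
      (∀ i : Fin n, 0 < (i : ℕ) → (i : ℕ) + 1 < n → InPosition (C i) 2 → k i = 2) := by
  obtain ⟨s, e, hs, he, hes, hne, hadj⟩ := hC.exists_start_end
  choose f k L hf0 hfk hk using fun i =>
    (hC.isCycleSubgraph i).exists_labelling_pair (hs i) (he i) (hne i)
  have hcut : ∀ i : Fin n, ∀ x ∈ (C i).verts, IsCutVertex G x → x = s i ∨ x = e i := by
    intro i x hx hxc
    obtain ⟨j, hji, hj⟩ := hC.exists_mem_of_isCutVertex hx hxc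
    rcases hC.consecutive_of_mem hji hj hx with h | h
    · exact Or.inl (hC.eq_of_mem_of_mem hji hj hx (hes j i h ▸ he j) (hs i))
    · exact Or.inr (hC.eq_of_mem_of_mem hji hj hx ((hes i j h).symm ▸ hs j) (he i))
  have hone : ∀ i, (C i).Adj (s i) (e i) → k i = 1 := by
    intro i h
    rw [← hf0 i, ← hfk i] at h
    exact (L i).eq_one_of_adj (hk i) h
  refine ⟨k, f, ⟨?_, fun i => (L i).closed, ?_, ?_, ?_⟩, hk, fun i hi => hone i (hadj i hi),
    ?_, ?_⟩
  · intro i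
    have := hk i
    unfold IsPosition at this
    omega
  · intro v
    obtain ⟨i, hi⟩ := hC.exists_mem_verts hn v
    exact ⟨i, ((L i).mem_iff v).1 hi⟩
  · intro v w
    rw [hC.adj_iff]
    exact exists_congr fun i => (L i).adj_iff v w
  · have hlt : ∀ i, k i < (C i).verts.ncard := fun i => by
      have := hk i
      unfold IsPosition at this
      omega
    have h0 : ∀ i, 0 < (C i).verts.ncard := fun i => (Nat.zero_le _).trans_lt (hlt i)
    have key : ∀ i j : Fin n, ∀ a < (C i).verts.ncard, ∀ b < (C j).verts.ncard,
        (i : ℕ) + 1 = j → f i a = f j b → a = k i ∧ b = 0 := by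
      intro i j a ha b hb hij hab
      have hij' : i ≠ j := by rintro rfl; omega
      have hi := (L i).mem ha
      have hj := (L j).mem hb
      have h1 := hC.eq_of_mem_of_mem hij' hi (hab ▸ hj) (he i) (hes i j hij ▸ hs j)
      refine ⟨(L i).inj _ ha _ (hlt i) (h1.trans (hfk i).symm), (L j).inj _ hb _ (h0 j) ?_⟩
      rw [← hab, h1, hes i j hij, hf0]
    intro i j a ha b hb
    constructor
    · intro hab
      by_cases hij : i = j
      · subst hij
        exact Or.inl ⟨rfl, (L i).inj _ ha _ hb hab⟩
      · rcases hC.consecutive_of_mem hij ((L i).mem ha) (hab ▸ (L j).mem hb) with h | h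
        · exact Or.inr (Or.inl ⟨h, key i j a ha b hb h hab⟩)
        · exact Or.inr (Or.inr ⟨h, key j i b hb a ha h hab.symm⟩)
    · rintro (⟨rfl, rfl⟩ | ⟨h, rfl, rfl⟩ | ⟨h, rfl, rfl⟩)
      · rfl
      · rw [hfk, hf0, hes i j h]
      · rw [hfk, hf0, hes j i h]
  · intro i _ _ hpos
    obtain ⟨u, v, hu, hv, hd⟩ := hpos.exists_of_cutVertices (hcut i)
    rw [SimpleGraph.dist_eq_one_iff_adj, SimpleGraph.Subgraph.coe_adj, hu, hv] at hd
    exact hone i hd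
  · intro i _ _ hpos
    obtain ⟨u, v, hu, hv, hd⟩ := hpos.exists_of_cutVertices (hcut i)
    -- Position 1 would make the cut vertices adjacent, at distance 1 instead of 2; otherwise the
    -- middle vertex of a walk of length 2 forces position 2.
    have hk1 : k i ≠ 1 := by
      intro h1
      have := (L i).adj_succ (a := 0) ((hk i).2.2.trans_lt' (by norm_num))
      rw [zero_add, ← h1, hfk, hf0, ← hu, ← hv, ← SimpleGraph.Subgraph.coe_adj,
        ← SimpleGraph.dist_eq_one_iff_adj, hd] at this
      omega
    obtain ⟨p, hp⟩ := SimpleGraph.exists_walk_of_dist_ne_zero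
      (show (C i).coe.dist u v ≠ 0 by rw [hd]; norm_num)
    rw [hd] at hp
    match p, hp with
    | .cons (v := w) h1 (.cons h2 .nil), _ =>
      rw [SimpleGraph.Subgraph.coe_adj] at h1 h2
      rw [hu, ← hf0 i] at h1
      rw [hv, ← hfk i] at h2
      exact (L i).eq_two_of_adj_of_adj (hk i) hk1 h1 h2

end IsChainCactusWith

end ChainCacti

/-! ### Comparison of the three chains -/

theorem mainTheorem2 {VA VO VM : Type*} [Finite VA] [Finite VO] [Finite VM] (n : ℕ)
    (A : SimpleGraph VA) (CA : Fin n → A.Subgraph) (hA : ChainCacti.IsChainCactusWith A CA)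
    (O : SimpleGraph VO) (CO : Fin n → O.Subgraph) (hO : ChainCacti.IsOrthoChain O CO)
    (M : SimpleGraph VM) (CM : Fin n → M.Subgraph) (hM : ChainCacti.IsMetaChain M CM)
    (hsizeO : ∀ i, (CO i).verts.ncard = (CA i).verts.ncard)
    (hsizeM : ∀ i, (CM i).verts.ncard = (CA i).verts.ncard)
    (hAO : ¬ Nonempty (A ≃g O)) (hAM : ¬ Nonempty (A ≃g M)) :
    ChainCacti.numIndepSets O < ChainCacti.numIndepSets A ∧
      ChainCacti.numIndepSets A < ChainCacti.numIndepSets M := by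
  open ChainCacti in
  rcases Nat.eq_zero_or_pos n with hn | hn
  -- All chains of length 0 are one-vertex graphs, hence isomorphic.
  · exfalso
    obtain ⟨hs, ⟨a⟩⟩ := Nat.card_eq_one_iff_unique.1 (hA.card_eq_one hn)
    obtain ⟨hs', ⟨o⟩⟩ := Nat.card_eq_one_iff_unique.1 (hO.1.card_eq_one hn)
    exact hAO ⟨⟨⟨fun _ => o, fun _ => a, fun _ => Subsingleton.elim _ _,
      fun _ => Subsingleton.elim _ _⟩, fun {x y} => by
        rw [Subsingleton.elim x y]
        simp⟩⟩
  obtain ⟨kA, fA, LA, pA, eA, -, -⟩ := hA.exists_labelling hn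
  obtain ⟨kO, fO, LO, pO, eO, oO, -⟩ := hO.1.exists_labelling hn
  obtain ⟨kM, fM, LM, pM, eM, -, mM⟩ := hM.1.exists_labelling hn
  simp only [hsizeO] at LO pO
  simp only [hsizeM] at LM pM
  have hkO : ∀ i, kO i = 1 := by
    intro i
    by_cases h : (i : ℕ) = 0 ∨ (i : ℕ) + 1 = n
    · exact eO i h
    · exact oO i (by omega) (by omega) (hO.2 i (by omega) (by omega))
  have hkM : ∀ i : Fin n, 0 < (i : ℕ) → (i : ℕ) + 1 < n → kM i = 2 :=
    fun i h1 h2 => mM i h1 h2 (hM.2 i h1 h2)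
  have p2 : ∀ i : Fin n, 0 < (i : ℕ) → (i : ℕ) + 1 < n → IsPosition (CA i).verts.ncard 2 :=
    fun i h1 h2 => hkM i h1 h2 ▸ pM i
  rw [LA.numIndepSets_eq (fun i => (pA i).1) hn, LO.numIndepSets_eq (fun i => (pO i).1) hn,
    LM.numIndepSets_eq (fun i => (pM i).1) hn]
  constructor
  · refine chainWeight_le_lt _ _ _ pO pA ?_ ?_ (fun i hi => by rw [hkO, eA i (Or.inl hi)])
    · intro i
      rw [hkO, cycleWeight_true_true_one]
      exact Nat.zero_le _
    -- End cycles have position 1 in every labelling, so without a strict inequality at an internal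
    -- cycle all positions agree and the graphs are isomorphic.
    · by_contra! hcon
      refine hAO (LA.nonempty_iso (f' := fO) ?_)
      convert LO using 1
      funext i
      rw [hkO]
      by_contra hne
      have hi : ¬ ((i : ℕ) = 0 ∨ (i : ℕ) + 1 = n) := fun h => hne (eA i h)
      have := hcon i (by omega) (by omega)
      rw [hkO, cycleWeight_true_true_one] at this
      exact absurd (cycleWeight_true_true_pos (pA i) hne) (by omega)
  · refine chainWeight_le_lt _ _ _ pA pM ?_ ?_
      (fun i hi => by rw [eM i (Or.inl hi), eA i (Or.inl hi)])
    · intro i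
      by_cases h : (i : ℕ) = 0 ∨ (i : ℕ) + 1 = n
      · rw [eM i h, eA i h]
      · rw [hkM i (by omega) (by omega)]
        exact cycleWeight_true_true_le_two (pA i) (p2 i (by omega) (by omega))
    · by_contra! hcon
      refine hAM (LA.nonempty_iso (f' := fM) ?_)
      convert LM using 1
      funext i
      by_cases h : (i : ℕ) = 0 ∨ (i : ℕ) + 1 = n
      · rw [eM i h, eA i h]
      · have := hcon i (by omega) (by omega)
        rw [hkM i (by omega) (by omega)] at this ⊢
        by_contra hne
        exact absurd (cycleWeight_true_true_lt_two (pA i) (p2 i (by omega) (by omega)) hne)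
          (by omega)
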